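/- Conventions. A substitution is a map $\tau:\mathcal B\to\mathcal A^+$ from a finite alphabet to the nonempty finite words over a finite alphabet; $|\tau|=\min_{b\in\mathcal B}|\tau(b)|$ is its minimal length, and substitutions are composed after extending them to words by concatenation. A directive sequence $\boldsymbol\tau=(\tau_t)_{t\ge0}$ consists of nonempty finite alphabets $\mathcal A_t$ and substitutions $\tau_t:\mathcal A_{t+1}\to\mathcal A_t^+$; write $\tau_{[0,t)}=\tau_0\tau_1\cdots\tau_{t-1}$ (the identity for $t=0$). It is finitary if only finitely many distinct substitutions occur among the $\tau_t$. A desubstitution scheme of $x\in\mathcal A^{\mathbb Z}$ for $\tau$ is an increasing sequence $(k_s)_{s\in\mathbb Z}$ of integers for which there is $y\in\mathcal B^{\mathbb Z}$ (a desubstitution of $x$) with $x_{k_s}x_{k_s+1}\cdots x_{k_{s+1}-1}=\tau(y_s)$ for all $s\in\mathbb Z$; it is standard if $\max\{s: k_s\le0\}=0$. The substitution $\tau$ is quasi-recognizable if every $x\in\mathcal A^{\mathbb Z}$ has at most one standard desubstitution scheme, and injective if it is one-to-one on letters. The limit set $\Omega_{\boldsymbol\tau}$ is the set of all $x\in\mathcal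 A_0^{\mathbb Z}$ that admit a desubstitution for $\tau_{[0,t)}$ for every $t\ge0$; it carries the topology induced by the product topology (of discrete alphabets) and the shift $\sigma(x)_i=x_{i+1}$. A dynamical system $(X,f)$ is aperiodic if $f$ has no periodic point. For a metric $d$ on $X$, $(X,f)$ is finitely positively expansive if there are $n\ge1$ and $\varepsilon>0$ such that for every $x\in X$ at most $n$ points $y\in X$ satisfy $d(f^t(x),f^t(y))<\varepsilon$ for all integers $t\ge0$. Corollary. Let $\boldsymbol\tau$ be a finitary directive sequence such that $|\tau_{[0,t)}|$ grows exponentially, i.e. there are $c>0$ and $\rho>1$ with $|\tau_{[0,t)}|\ge c\rho^t$ for all $t\ge0$. Suppose that either all the substitutions $\tau_t$ are injective and quasi-recognizable, or $(\Omega_{\boldsymbol\tau},\sigma)$ is aperiodic. Then $(\Omega_{\boldsymbol\tau},\sigma)$ is finitely positively expansive, for every metric on $\Omega_{\boldsymbol\tau}$ that induces its topology. -/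

import Mathlib

/-! Symbolic dynamics: configurations, substitutions, directive sequences and their limit sets. -/

namespace SAdic

/-- The space `C ^ ℤ` of two-sided configurations over the alphabet `C`. -/
abbrev Config (C : Type*) := ℤ → C

/-- The product topology on `C ^ ℤ`, the alphabet `C` being discrete. -/
abbrev configTopology (C : Type*) : TopologicalSpace (Config C) :=
  @Pi.topologicalSpace ℤ (fun _ => C) (fun _ => ⊥)

/-- The shift action `σ(x)_i = x_{i+1}`. -/
def shift {C : Type*} (x : Config C) : Config C := fun i => x (i + 1)

/-- The finite word `x_i x_{i+1} … x_{j-1}`. -/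
def factor {C : Type*} (x : Config C) (i j : ℤ) : List C :=
  (List.range (j - i).toNat).map fun n => x (i + n)

/-- A (non-erasing) substitution `B → C⁺`. -/
structure Substitution (B C : Type*) where
  /-- the image of a letter -/
  word : B → List C
  word_ne_nil : ∀ b, word b ≠ []

namespace Substitution

/-- The trivial substitution, sending each letter to itself. -/
def id (B : Type*) : Substitution B B where
  word b := [b]
  word_ne_nil _ := by simp

/-- The composition `τ τ'`: apply `τ'`, then `τ` letter by letter. -/
def comp {B C D : Type*} (τ : Substitution C D) (τ' : Substitution B C) : Substitution B D where
  word b := (τ'.word b).flatMap τ.word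
  word_ne_nil b := by
    intro h
    rw [List.flatMap_eq_nil_iff] at h
    obtain ⟨c, hc⟩ := List.exists_mem_of_ne_nil _ (τ'.word_ne_nil b)
    exact τ.word_ne_nil c (h c hc)

/-- The minimal length `|τ| = min_b |τ(b)|` (for a nonempty alphabet). -/
noncomputable def minLength {B C : Type*} (τ : Substitution B C) : ℕ :=
  ⨅ b, (τ.word b).length

/-- `τ` is one-to-one as a map on letters. -/
def Injective {B C : Type*} (τ : Substitution B C) : Prop :=
  Function.Injective τ.word

/-- `y` is a desubstitution of `x` for `τ`, with scheme `k`. -/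
def IsDesubstitution {B C : Type*} (τ : Substitution B C) (x : Config C) (k : ℤ → ℤ)
    (y : Config B) : Prop :=
  StrictMono k ∧ ∀ s, factor x (k s) (k (s + 1)) = τ.word (y s)

/-- `k` is a desubstitution scheme of `x` for `τ`. -/
def IsScheme {B C : Type*} (τ : Substitution B C) (x : Config C) (k : ℤ → ℤ) : Prop :=
  ∃ y, τ.IsDesubstitution x k y

/-- A scheme `k` is standard when `max {s | k_s ≤ 0} = 0`. -/
def IsStandard (k : ℤ → ℤ) : Prop :=
  IsGreatest {s : ℤ | k s ≤ 0} 0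

/-- Every element of `X` has at most one standard desubstitution scheme. -/
def QuasiRecognizableOn {B C : Type*} (τ : Substitution B C) (X : Set (Config C)) : Prop :=
  ∀ x ∈ X, ∀ k k' : ℤ → ℤ, τ.IsScheme x k → IsStandard k → τ.IsScheme x k' → IsStandard k' →
    k = k'

/-- Quasi-recognizability over the full shift. -/
def QuasiRecognizable {B C : Type*} (τ : Substitution B C) : Prop :=
  τ.QuasiRecognizableOn Set.univ

/-- The set of configurations which admit a desubstitution for `τ`. -/
def image {B C : Type*} (τ : Substitution B C) : Set (Config C) :=
  {x | ∃ k y, τ.IsDesubstitution x k y}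

theorem shift_mem_image {B C : Type*} (τ : Substitution B C) {x : Config C} (hx : x ∈ τ.image) :
    shift x ∈ τ.image := by
  obtain ⟨k, y, hk, hy⟩ := hx
  refine ⟨fun s => k s - 1, y, fun a b hab => sub_lt_sub_right (hk hab) 1, fun s => ?_⟩
  rw [← hy s]
  have h1 : k (s + 1) - 1 - (k s - 1) = k (s + 1) - k s := by ring
  simp only [factor, shift, h1]
  refine List.map_congr_left fun n _ => congrArg x ?_
  ring

end Substitution

/-- A directive sequence: nonempty finite alphabets `A_t` (sets of symbols taken in `S`) and
substitutions `τ_t : A_{t+1} → A_t⁺`. -/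
structure DirectiveSequence (S : Type*) where
  /-- the alphabet `A_t` -/
  alphabet : ℕ → Finset S
  alphabet_nonempty : ∀ t, (alphabet t).Nonempty
  /-- the substitution `τ_t` -/
  subst : ∀ t, Substitution (alphabet (t + 1)) (alphabet t)

namespace DirectiveSequence

variable {S : Type*}

/-- The composition `τ_0 τ_1 ⋯ τ_{t-1}`. -/
def composed (τ : DirectiveSequence S) : ∀ t, Substitution (τ.alphabet t) (τ.alphabet 0)
  | 0 => Substitution.id _
  | t + 1 => (τ.composed t).comp (τ.subst t)

/-- Only finitely many distinct substitutions (taken with their alphabets) occur. -/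
def Finitary (τ : DirectiveSequence S) : Prop :=
  (Set.range fun t => (⟨(τ.alphabet (t + 1), τ.alphabet t), τ.subst t⟩ :
    Σ p : Finset S × Finset S, Substitution p.1 p.2)).Finite

/-- The minimal length of `τ_0 ⋯ τ_{t-1}` grows at least like a geometric sequence of
ratio `ρ > 1`. -/
def GrowsExponentially (τ : DirectiveSequence S) : Prop :=
  ∃ c : ℝ, 0 < c ∧ ∃ ρ : ℝ, 1 < ρ ∧ ∀ t : ℕ, c * ρ ^ t ≤ ((τ.composed t).minLength : ℝ)

/-- The S-adic limit set `Ω`. -/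
def limitSet (τ : DirectiveSequence S) : Set (Config (τ.alphabet 0)) :=
  ⋂ t, (τ.composed t).image

theorem mapsTo_shift (τ : DirectiveSequence S) : Set.MapsTo shift τ.limitSet τ.limitSet := by
  intro x hx
  simp only [limitSet, Set.mem_iInter] at hx ⊢
  exact fun t => (τ.composed t).shift_mem_image (hx t)

/-- The shift action on the limit set. -/
def shiftMap (τ : DirectiveSequence S) : τ.limitSet → τ.limitSet :=
  τ.mapsTo_shift.restrict shift τ.limitSet τ.limitSet

/-- The topology on the limit set induced by `A_0 ^ ℤ`. -/
abbrev limitTopology (τ : DirectiveSequence S) : TopologicalSpace τ.limitSet :=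
  (configTopology (τ.alphabet 0)).induced Subtype.val

end DirectiveSequence

/-- A dynamical system is aperiodic when it has no periodic point. -/
def Aperiodic {X : Type*} (f : X → X) : Prop :=
  Function.periodicPts f = ∅

/-- `(X, f)` is positively `n`-expansive with constant `ε`. -/
def PositivelyExpansiveWith {X : Type*} [MetricSpace X] (f : X → X) (n : ℕ) (ε : ℝ) : Prop :=
  ∀ x : X, {y : X | ∀ t : ℕ, dist (f^[t] x) (f^[t] y) < ε}.encard ≤ n

/-- `(X, f)` is positively `n`-expansive for some `n ≥ 1`. -/
def FinitelyPositivelyExpansive {X : Type*} [MetricSpace X] (f : X → X) : Prop :=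
  ∃ n : ℕ, 1 ≤ n ∧ ∃ ε : ℝ, 0 < ε ∧ PositivelyExpansiveWith f n ε

end SAdic

/-!
The hypotheses enter in three ways only: the alphabets have at most `K` letters, the minimal length
of `τ_0 ⋯ τ_{t-1}` is unbounded, and the limit set `Ω` is aperiodic. The last is assumed in one
case. In the other case, the unique standard scheme of a point of period `p` is invariant under the
translation by `p`, so each desubstitution is periodic again and its scheme advances by `p` over
each period; as the gaps of the scheme are at least the minimal length of `τ_0 ⋯ τ_{t-1}`, this is
impossible for large `t` (`aperiodic_of_recognizable`).

For a compatible metric, points which are close agree at the origin (`exists_dist_lt`, by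
compactness of `Ω`). So it suffices to bound the cardinality of a finite set `T ⊆ Ω` of points which
agree on `[0, ∞)`, by a number which depends on `K` alone. Let the points of `T` be pairwise
distinct on `[-D, 0)`. By compactness and aperiodicity, stretches with a period at most `D` have
length less than some `G`, and stretches with a period at most `D + G` also have bounded length
(`exists_repeats_lt`). For large `t`, the words of `τ_0 ⋯ τ_{t-1}` are much longer than these
constants, and they tile all points of `T`. The bound `card_le_asymptoticBound` is proved by
induction on the number of words of such a tiling.

* Points with a cut of the tiling in `[-D, G]` are determined by the two words at the cut
  (`card_le_of_cut`), so there are at most as many of them as pairs of words.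
* The others are grouped by the word which covers the origin. In one group, ordered by the right
  ends `b i` of this word, the common right half of the points has a prefix of length `b j` with a
  border of length `b i` whenever `i < j`: a `Ladder`. If some `b l` were at most `b i + b j` with
  `i < j < l`, the theorem of Fine and Wilf would give a common divisor of `b l - b i` and
  `b l - b j` as a period, and the `i`-th and the `j`-th point would agree on `[-D, 0)`. So the
  `b i` grow at least like the Fibonacci numbers (`Ladder.add_lt`).
* In a ladder with many rungs, the pigeonhole principle gives many consecutive rungs, from the
  `i`-th one on, between which the tiling uses words much shorter than `b (i + 1)` only
  (`Ladder.exists_short`). The common word ends with a copy of this part of the right half, so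
  these short words tile the points on the next rungs in a large window around the origin
  (`Ladder.exists_tiles`). The common word itself is not short, so fewer words are in use, and the
  induction hypothesis bounds the number of these rungs.
-/

namespace SAdic

/-! ### Factors of configurations -/

/-- In `factor`, the list of indices is coerced to a list of integers as a whole; here each index is
coerced on its own. -/
theorem factor_eq_map {α : Type*} (x : Config α) (i j : ℤ) :
    factor x i j = (List.range (j - i).toNat).map fun n : ℕ => x (i + (n : ℤ)) := by
  unfold factor
  generalize List.range (j - i).toNat = l
  change List.map _ (l.flatMap fun n : ℕ => [(n : ℤ)]) = _
  induction l with
  | nil => rfl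
  | cons a l ih => simp_all

theorem factor_getElem? {α : Type*} (x : Config α) (i j : ℤ) (n : ℕ) :
    (factor x i j)[n]? = if n < (j - i).toNat then some (x (i + n)) else none := by
  rw [factor_eq_map]
  split_ifs with h
  · simp [List.getElem?_map, List.getElem?_range h]
  · simpa [List.getElem?_map] using h

@[simp] theorem factor_length {α : Type*} (x : Config α) (i j : ℤ) :
    (factor x i j).length = (j - i).toNat := by
  simp [factor_eq_map]

theorem factor_eq_iff {α : Type*} {x y : Config α} {i j k l : ℤ} (hij : i ≤ j) (hkl : k ≤ l) :
    factor x i j = factor y k l ↔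
      j - i = l - k ∧ ∀ n, 0 ≤ n → n < j - i → x (i + n) = y (k + n) := by
  constructor
  · intro h
    have hlen := congrArg List.length h
    simp only [factor_length] at hlen
    refine ⟨by omega, fun n h0 h1 => ?_⟩
    have := congrArg (fun u : List α => u[n.toNat]?) h
    simp only [factor_getElem?] at this
    rw [if_pos (by omega), if_pos (by omega), Option.some_inj] at this
    convert! this using 2 <;> omega
  · rintro ⟨h1, h2⟩
    refine List.ext_getElem? fun n => ?_
    simp only [factor_getElem?, h1]
    split_ifs with hn
    · rw [h2 n (by omega) (by omega)]
    · rfl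

theorem factor_append {α : Type*} (x : Config α) {i j k : ℤ} (hij : i ≤ j) (hjk : j ≤ k) :
    factor x i j ++ factor x j k = factor x i k := by
  refine List.ext_getElem? fun n => ?_
  rw [List.getElem?_append, factor_getElem?, factor_getElem?, factor_getElem?, factor_length]
  split_ifs <;> first | rfl | omega | exact congrArg (some ∘ x) (by omega)

theorem factor_eq_of_append {α : Type*} {x : Config α} {i k : ℤ} {P M Q : List α}
    (h : factor x i k = P ++ M ++ Q) :
    factor x (i + P.length) (i + P.length + M.length) = M := by
  have hlen := congrArg List.length h
  simp only [factor_length, List.length_append] at hlen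
  rcases Nat.eq_zero_or_pos M.length with hM | hM
  -- for empty words, the factor may be a junk value with `k < i`
  · rw [List.length_eq_zero_iff.1 hM]
    exact List.length_eq_zero_iff.1 (by simp)
  rw [← factor_append x (show i ≤ i + P.length + M.length by omega) (by omega),
    ← factor_append x (show i ≤ i + P.length by omega) (by omega)] at h
  exact (List.append_inj (List.append_inj h (by simp)).1 (by simp)).2

/-! ### Periodic stretches of configurations -/

/-- The configuration `w` repeats itself at distance `p` from every position of `[a, b)`; so the
factor of `w` on `[a, b + p)` has period `p`. -/
def Repeats {α : Type*} (w : Config α) (a b p : ℤ) : Prop :=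
  ∀ q, a ≤ q → q < b → w q = w (q + p)

theorem factor_hasPeriod_iff {α : Type*} {w : Config α} {n p : ℤ} (hp : 0 < p) :
    (factor w 0 n).HasPeriod p.toNat ↔ Repeats w 0 (n - p) p := by
  rw [List.hasPeriod_iff_getElem?]
  simp only [factor_getElem?, factor_length]
  constructor
  · intro h q h0 h1
    have := h q.toNat (by omega)
    rw [if_pos (by omega), if_pos (by omega), Option.some_inj] at this
    convert! this using 2 <;> omega
  · intro h i hi
    rw [if_pos (by omega), if_pos (by omega), h (0 + i) (by omega) (by omega)]
    congr 2
    omega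

/-- The theorem of Fine and Wilf, for a prefix of the right half of a configuration. -/
theorem Repeats.exists_common_divisor {α : Type*} {w : Config α} {n p q : ℤ}
    (hp : 0 < p) (hq : 0 < q) (hn : p + q ≤ n)
    (h1 : Repeats w 0 (n - p) p) (h2 : Repeats w 0 (n - q) q) :
    ∃ g, 0 < g ∧ g ∣ p ∧ g ∣ q ∧ Repeats w 0 (n - g) g := by
  lift p to ℕ using hp.le
  lift q to ℕ using hq.le
  have hg : 0 < Nat.gcd p q := Nat.gcd_pos_of_pos_left _ (by omega)
  refine ⟨(Nat.gcd p q : ℕ), by exact_mod_cast hg, by exact_mod_cast Nat.gcd_dvd_left p q,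
    by exact_mod_cast Nat.gcd_dvd_right p q, ?_⟩
  rw [← factor_hasPeriod_iff (by omega)] at h1 h2
  rw [← factor_hasPeriod_iff (by exact_mod_cast hg)]
  exact h1.gcd h2 (by simp; omega)

theorem Repeats.eq_of_dvd {α : Type*} {w : Config α} {n g a b : ℤ} (hg : 0 < g)
    (h : Repeats w 0 (n - g) g) (ha : 0 ≤ a) (hab : a ≤ b) (hb : b < n) (hd : g ∣ b - a) :
    w a = w b := by
  obtain ⟨c, hc⟩ := hd
  have hc0 : 0 ≤ c := by
    by_contra hneg
    have : g * c < 0 := mul_neg_of_pos_of_neg hg (by omega)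
    omega
  lift c to ℕ using hc0
  obtain rfl : b = a + g * c := by omega
  clear hc hab
  induction c with
  | zero => simp
  | succ c ih =>
    push_cast at hb ⊢
    have h1 : 0 ≤ g * c := by positivity
    rw [ih (by nlinarith), h (a + g * c) (by omega) (by nlinarith)]
    congr 1
    ring

/-! ### Asymptotic configurations covered by a common word -/

/-- A family of `m` configurations which agree on `[0, ∞)`, are pairwise distinct on `[-D, 0)`, and
each of which shows one and the same word of length `v` just to the left of a position `b i`, the
positions `b i` being increasing and the word covering `[-D, G]` in each case. Stretches longer
than `G` with a period at most `D` are excluded. -/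
structure Ladder {α : Type*} (D G v : ℤ) (m : ℕ) (X : ℕ → Config α) (b : ℕ → ℤ) : Prop where
  D_pos : 0 < D
  G_pos : 0 < G
  tail : ∀ i < m, ∀ j < m, ∀ q, 0 ≤ q → X i q = X j q
  distinct : ∀ i < m, ∀ j < m, (∀ q, -D ≤ q → q < 0 → X i q = X j q) → i = j
  suffix : ∀ i < m, ∀ j < m, ∀ q, -v ≤ q → q < 0 → X i (b i + q) = X j (b j + q)
  lt_of_lt : ∀ i j, i < j → j < m → b i < b j
  G_lt : ∀ i < m, G < b i
  add_D_lt : ∀ i < m, b i + D < v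
  repeats_lt : ∀ i < m, ∀ a c p, 0 < p → p ≤ D → Repeats (X i) a c p → c - a < G

namespace Ladder

variable {α : Type*} {D G v : ℤ} {m : ℕ} {X : ℕ → Config α} {b : ℕ → ℤ}

/-- The prefix of length `b i` of the common right half is a border of the prefix of length
`b j`. -/
theorem border (h : Ladder D G v m X b) {i j k : ℕ} (hi : i < m) (hj : j < m) (hk : k < m)
    (hij : i < j) : Repeats (X k) 0 (b i) (b j - b i) := by
  intro q h0 h1
  have hb := h.lt_of_lt i j hij hj
  have hv := h.add_D_lt i hi
  have hD := h.D_pos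
  have := h.suffix i hi j hj (q - b i) (by omega) (by omega)
  rw [h.tail k hk i hi q h0, h.tail k hk j hj _ (by omega)]
  convert! this using 2 <;> ring

/-- A short period of the prefix of length `b l` would divide the differences `b l - b i` and
`b l - b j`, by Fine and Wilf, and so identify the `i`-th and the `j`-th configuration. -/
theorem not_repeats (h : Ladder D G v m X b) {i j l : ℕ} (hij : i < j) (hjl : j < l) (hl : l < m)
    {p : ℤ} (hp : 0 < p) (hpb : p ≤ b i) : ¬ Repeats (X l) 0 (b l - p) p := by
  intro hrep
  have hbij := h.lt_of_lt i j hij (by omega)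
  have hbjl := h.lt_of_lt j l hjl hl
  have hb1 : Repeats (X l) 0 (b l - (b l - b j)) (b l - b j) := by
    simpa using h.border (hjl.trans hl) hl hl hjl
  have hb2 : Repeats (X l) 0 (b l - (b l - b i)) (b l - b i) := by
    simpa using h.border ((hij.trans hjl).trans hl) hl hl (hij.trans hjl)
  obtain ⟨g, hg, hgp, hgj, hrg⟩ := hrep.exists_common_divisor hp (by omega) (by omega) hb1
  have hgle : g ≤ p := Int.le_of_dvd hp hgp
  obtain ⟨g', hg', hgg', hgi, hrg'⟩ := hrg.exists_common_divisor hg (by omega) (by omega) hb2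
  have hgj' : g' ∣ b l - b j := hgg'.trans hgj
  -- the shift `b l - b j` is a period of a long prefix, so it exceeds `D`
  have hbig : D < b l - b j := by
    by_contra hle
    have := h.repeats_lt l hl 0 (b l - (b l - b j)) (b l - b j) (by omega) (by omega) hb1
    have := h.G_lt j (by omega)
    omega
  refine hij.ne' (h.distinct j (by omega) i (by omega) fun q hq hq0 => ?_)
  have hvj := h.add_D_lt j (by omega)
  have e1 := h.suffix j (by omega) l hl (q - b j) (by omega) (by omega)
  have e2 := h.suffix i (by omega) l hl (q - b i) (by omega) (by omega)
  rw [show b j + (q - b j) = q by ring] at e1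
  rw [show b i + (q - b i) = q by ring] at e2
  rw [e1, e2]
  refine hrg'.eq_of_dvd hg' (by omega) (by omega) (by omega) ?_
  have := dvd_sub hgi hgj'
  convert! this using 1
  ring

theorem add_lt (h : Ladder D G v m X b) {i j l : ℕ} (hij : i < j) (hjl : j < l) (hl : l < m) :
    b i + b j < b l := by
  by_contra hle
  have hbjl := h.lt_of_lt j l hjl hl
  refine h.not_repeats hij hjl hl (p := b l - b j) (by omega) (by omega) ?_
  simpa using h.border (hjl.trans hl) hl hl hjl

theorem le_of_le (h : Ladder D G v m X b) {i j : ℕ} (hij : i ≤ j) (hj : j < m) : b i ≤ b j := by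
  rcases hij.eq_or_lt with rfl | hlt
  · exact le_rfl
  · exact (h.lt_of_lt i j hlt hj).le

theorem two_mul_lt (h : Ladder D G v m X b) {i : ℕ} (hi : i + 2 < m) : 2 * b i < b (i + 2) := by
  have h1 := h.add_lt (show i < i + 1 by omega) (show i + 1 < i + 2 by omega) hi
  have h2 := h.lt_of_lt i (i + 1) (by omega) (by omega)
  omega

theorem eight_mul_lt (h : Ladder D G v m X b) {i j : ℕ} (hij : i + 6 ≤ j) (hj : j < m) :
    8 * b i < b j := by
  have h1 := h.two_mul_lt (i := i) (by omega)
  have h2 := h.two_mul_lt (i := i + 2) (by omega)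
  have h3 := h.two_mul_lt (i := i + 4) (by omega)
  have h4 := h.le_of_le hij hj
  simp only [Nat.add_assoc, Nat.reduceAdd] at h1 h2 h3
  omega

/-- A long word cannot occur twice close to the origin in the common right half: the distance of
the occurrences would be a short period of some prefix. -/
theorem lt_of_repeats (h : Ladder D G v m X b) {i : ℕ} (hi : i + 3 < m) {e e' n : ℤ}
    (he : 0 ≤ e) (hee : e < e') (heb : e' ≤ b i) (hrep : Repeats (X i) e (e + n) (e' - e)) :
    e' + n < b (i + 3) := by
  by_contra hle
  have h1 := h.add_lt (show i + 1 < i + 2 by omega) (show i + 2 < i + 3 by omega) hi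
  have h2 := h.lt_of_lt i (i + 1) (by omega) (by omega)
  refine h.not_repeats (show i < i + 1 by omega) (show i + 1 < i + 2 by omega) (by omega)
    (p := e' - e) (by omega) (by omega) fun q hq0 hq => ?_
  have hb := h.border (show i + 2 < m by omega) hi (show i + 2 < m by omega)
    (show i + 2 < i + 3 by omega)
  have ht := h.tail i (by omega) (i + 2) (by omega)
  have hr := hrep (q + (b (i + 3) - b (i + 2))) (by omega) (by omega)
  rw [ht _ (by omega), ht _ (by omega)] at hr
  rw [hb q hq0 (by omega), hr, hb (q + (e' - e)) (by omega) (by omega)]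
  congr 1
  ring

end Ladder

/-! ### Tilings of configurations by finitely many words -/

/-- On the window `[A, B)`, the configuration `x` is tiled by words of `S`; the word covering the
position `q` occupies `[st q, en q)`. The outermost words may exceed the window. -/
structure Tiles {α : Type*} (S : Finset (List α)) (x : Config α) (A B : ℤ)
    (st en : ℤ → ℤ) : Prop where
  st_le : ∀ q, A ≤ q → q < B → st q ≤ q
  lt_en : ∀ q, A ≤ q → q < B → q < en q
  mem : ∀ q, A ≤ q → q < B → factor x (st q) (en q) ∈ S
  st_eq : ∀ q, A ≤ q → q < B → ∀ r, st q ≤ r → r < en q → st r = st q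
  en_eq : ∀ q, A ≤ q → q < B → ∀ r, st q ≤ r → r < en q → en r = en q

namespace Tiles

variable {α : Type*} {S : Finset (List α)} {x : Config α} {A B : ℤ} {st en : ℤ → ℤ}

theorem st_st (h : Tiles S x A B st en) {q : ℤ} (hA : A ≤ q) (hB : q < B) :
    st (st q) = st q :=
  h.st_eq q hA hB _ le_rfl ((h.st_le q hA hB).trans_lt (h.lt_en q hA hB))

theorem en_st (h : Tiles S x A B st en) {q : ℤ} (hA : A ≤ q) (hB : q < B) :
    en (st q) = en q :=
  h.en_eq q hA hB _ le_rfl ((h.st_le q hA hB).trans_lt (h.lt_en q hA hB))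

/-- No word of the tiling extends across a cut `c`. -/
theorem le_st (h : Tiles S x A B st en) {c q : ℤ} (hc : st c = c) (hA : A ≤ q) (hB : q < B)
    (hcq : c ≤ q) : c ≤ st q := by
  by_contra hlt
  have := h.st_eq q hA hB c (by omega) (hcq.trans_lt (h.lt_en q hA hB))
  omega

theorem en_le (h : Tiles S x A B st en) {c q : ℤ} (hc : st c = c) (hA : A ≤ q) (hB : q < B)
    (hqc : q < c) : en q ≤ c := by
  by_contra hlt
  have := h.st_eq q hA hB c ((h.st_le q hA hB).trans hqc.le) (by omega)
  have := h.st_le q hA hB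
  omega

theorem st_en (h : Tiles S x A B st en) {q : ℤ} (hA : A ≤ q) (hB : q < B) (hA' : A ≤ en q)
    (hB' : en q < B) : st (en q) = en q := by
  by_contra hne
  have h1 := h.st_le _ hA' hB'
  have h2 := h.lt_en _ hA' hB'
  have h3 := h.lt_en q hA hB
  have h4 := h.st_le q hA hB
  by_cases hcase : st (en q) ≤ q
  · have := h.en_eq _ hA' hB' q hcase (by omega)
    omega
  · have e1 := h.en_eq _ hA' hB' (st (en q)) le_rfl (by omega)
    have e2 := h.en_eq q hA hB (st (en q)) (by omega) (by omega)
    omega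

theorem en_sub_st (h : Tiles S x A B st en) {q : ℤ} (hA : A ≤ q) (hB : q < B) :
    en q - st q = (factor x (st q) (en q)).length := by
  have := h.st_le q hA hB
  have := h.lt_en q hA hB
  rw [factor_length]
  omega

end Tiles

/-! ### Bounding families of asymptotic configurations -/

section Asymptotic

/-- The configurations of `T` agree on `[0, ∞)` and are pairwise distinct on `[-D, 0)`. Stretches
longer than `G` with a period at most `D`, and stretches of length about `L` with a period at most
`D + G`, are excluded. -/
structure Asymptotic {α : Type*} (D G L : ℤ) (T : Finset (Config α)) : Prop where
  D_pos : 0 < D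
  G_pos : 0 < G
  lt_L : D + G < L
  tail : ∀ x ∈ T, ∀ y ∈ T, ∀ q, 0 ≤ q → x q = y q
  distinct : ∀ x ∈ T, ∀ y ∈ T, (∀ q, -D ≤ q → q < 0 → x q = y q) → x = y
  repeats_lt : ∀ x ∈ T, ∀ a c p, 0 < p → p ≤ D → Repeats x a c p → c - a < G
  repeats_lt' : ∀ x ∈ T, ∀ a c p, 0 < p → p ≤ D + G → Repeats x a c p → c - a < L - D

variable {α : Type*} {D G L : ℤ}

theorem Asymptotic.mono {T T' : Finset (Config α)} (h : Asymptotic D G L T) (hT : T' ⊆ T) :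
    Asymptotic D G L T' where
  D_pos := h.D_pos
  G_pos := h.G_pos
  lt_L := h.lt_L
  tail x hx y hy := h.tail x (hT hx) y (hT hy)
  distinct x hx y hy := h.distinct x (hT hx) y (hT hy)
  repeats_lt x hx := h.repeats_lt x (hT hx)
  repeats_lt' x hx := h.repeats_lt' x (hT hx)

theorem exists_increasing {β γ : Type*} [LinearOrder γ] {T : Finset β} {f : β → γ}
    (hf : Set.InjOn f T) {m : ℕ} (hm0 : 0 < m) (hm : m ≤ T.card) :
    ∃ X : ℕ → β, (∀ i < m, X i ∈ T) ∧ ∀ i j, i < j → j < m → f (X i) < f (X j) := by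
  classical
  have hcard : (T.image f).card = T.card := Finset.card_image_of_injOn hf
  let e := (T.image f).orderEmbOfFin hcard
  have he : ∀ i : Fin T.card, ∃ x ∈ T, f x = e i := fun i =>
    Finset.mem_image.1 (Finset.orderEmbOfFin_mem _ hcard i)
  choose g hg hge using he
  refine ⟨fun i => if h : i < T.card then g ⟨i, h⟩ else g ⟨0, by omega⟩, fun i hi => ?_,
    fun i j hij hj => ?_⟩
  · simp only [dif_pos (hi.trans_le hm)]
    exact hg _
  · simp only [dif_pos (hj.trans_le hm), dif_pos ((hij.trans hj).trans_le hm), hge]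
    exact e.strictMono hij

/-- Configurations with a cut close to the origin are determined by the two words meeting at this
cut: the same words at a different cut would make the right one overlap itself. -/
theorem card_le_of_cut {T : Finset (Config α)} {S : Finset (List α)}
    {R : ℤ} {st en : Config α → ℤ → ℤ} (h : Asymptotic D G L T) (hL : ∀ u ∈ S, L ≤ u.length)
    (hR : D + G < R) (htile : ∀ x ∈ T, Tiles S x (-R) R (st x) (en x))
    (hcut : ∀ x ∈ T, ∃ c, -D ≤ c ∧ c ≤ G ∧ st x c = c) : T.card ≤ S.card ^ 2 := by
  have hD := h.D_pos
  have hG := h.G_pos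
  have hDG := h.lt_L
  choose! c hcD hcG hc using hcut
  have hlt : ∀ x ∈ T, L ≤ en x (c x) - c x := fun x hx => by
    have hD' := hcD x hx
    have hG' := hcG x hx
    have h1 := (htile x hx).en_sub_st (q := c x) (by omega) (by omega)
    have h2 := hL _ ((htile x hx).mem (c x) (by omega) (by omega))
    rw [hc x hx] at h1 h2
    omega
  have aux : ∀ x ∈ T, ∀ y ∈ T,
      factor x (c x) (en x (c x)) = factor y (c y) (en y (c y)) → ¬ c x < c y := by
    intro x hx y hy he hcc
    have hLx := hlt x hx
    have hLy := hlt y hy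
    have hD' := hcD x hx
    have hG' := hcG y hy
    obtain ⟨h1, h2⟩ := (factor_eq_iff (by omega) (by omega)).1 he
    have := h.repeats_lt' x hx (max 0 (c x)) (en x (c x)) (c y - c x) (by omega) (by omega)
      fun q hq1 hq2 => by
        have e1 := h2 (q - c x) (by omega) (by omega)
        rw [h.tail x hx y hy (q + (c y - c x)) (by omega)]
        convert! e1 using 2 <;> ring
    have := hcD x hx
    have := hcG x hx
    omega
  rw [sq, ← Finset.card_product]
  refine Finset.card_le_card_of_injOn
    (fun x => (factor x (st x (c x - 1)) (c x), factor x (c x) (en x (c x)))) ?_ ?_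
  · intro x hx
    have hx : x ∈ T := hx
    have t := htile x hx
    have hD' := hcD x hx
    have hG' := hcG x hx
    have e1 := t.en_le (hc x hx) (q := c x - 1) (by omega) (by omega) (by omega)
    have e2 := t.lt_en (c x - 1) (by omega) (by omega)
    have m1 := t.mem (c x - 1) (by omega) (by omega)
    have m2 := t.mem (c x) (by omega) (by omega)
    rw [show en x (c x - 1) = c x by omega] at m1
    rw [hc x hx] at m2
    exact Finset.mem_product.2 ⟨m1, m2⟩
  · intro x hx y hy hxy
    have hx : x ∈ T := hx
    have hy : y ∈ T := hy
    obtain ⟨hu, hv⟩ := Prod.ext_iff.1 hxy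
    simp only at hu hv
    have hcc : c x = c y :=
      le_antisymm (not_lt.1 (aux y hy x hx hv.symm)) (not_lt.1 (aux x hx y hy hv))
    have hD' := hcD x hx
    have hG' := hcG x hx
    have hLx := hlt x hx
    have hLy := hlt y hy
    have s1 := (htile x hx).st_le (c x - 1) (by omega) (by omega)
    have s2 := (htile y hy).st_le (c y - 1) (by omega) (by omega)
    have e1 := (htile x hx).en_le (hc x hx) (q := c x - 1) (by omega) (by omega) (by omega)
    have e2 := (htile x hx).lt_en (c x - 1) (by omega) (by omega)
    have l1 := hL _ ((htile x hx).mem (c x - 1) (by omega) (by omega))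
    rw [factor_length] at l1
    obtain ⟨u1, u2⟩ := (factor_eq_iff (by omega) (by omega)).1 hu
    obtain ⟨v1, v2⟩ := (factor_eq_iff (by omega) (by omega)).1 hv
    refine h.distinct x hx y hy fun q hq1 hq2 => ?_
    by_cases hq : q < c x
    · have := u2 (q - st x (c x - 1)) (by omega) (by omega)
      convert! this using 2 <;> omega
    · have := v2 (q - c x) (by omega) (by omega)
      convert! this using 2 <;> omega

/-- Among sufficiently many rungs of a ladder tiled by `S`, there are `n` consecutive ones between
which the tiling of the lowest one uses short words only. Otherwise, one long word would occur at
three heights: the lower two occurrences bound its length by `Ladder.lt_of_repeats`, while the third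
one is so high that the word must be longer. -/
theorem Ladder.exists_short {v R : ℤ} {m n : ℕ} {X : ℕ → Config α} {b : ℕ → ℤ}
    (h : Ladder D G v m X b) {S : Finset (List α)} {st en : ℕ → ℤ → ℤ}
    (htile : ∀ i < m, Tiles S (X i) (-R) R (st i) (en i)) (hR : ∀ i < m, b i < R)
    (hm : (2 * S.card + 1) * (n + 8) ≤ m) :
    ∃ i, i + n < m ∧ ∀ e, b i ≤ e → e < b (i + n) → st i e = e → 5 * (en i e - e) ≤ b (i + 1) := by
  classical
  by_contra hcon
  push Not at hcon
  -- Divide the rungs into blocks of `n + 8`, with a long word between the first `n` of each. The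
  -- other `8` make the rung `n + 3` of a block less than an eighth of the rung `1` of the next.
  have hG := h.G_pos
  have hidx : ∀ a ∈ Finset.range (2 * S.card + 1), (n + 8) * a + n + 8 ≤ m := fun a ha => by
    have : a + 1 ≤ 2 * S.card + 1 := Finset.mem_range.1 ha
    have := Nat.mul_le_mul_left (n + 8) this
    rw [mul_comm] at hm
    rw [mul_add] at this
    omega
  have hE : ∀ a ∈ Finset.range (2 * S.card + 1), ∃ e, b ((n + 8) * a) ≤ e ∧
      e < b ((n + 8) * a + n) ∧ st ((n + 8) * a) e = e ∧
      b ((n + 8) * a + 1) < 5 * (en ((n + 8) * a) e - e) := fun a ha => by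
    have := hidx a ha
    exact hcon ((n + 8) * a) (by omega)
  choose! e he1 he2 he3 he4 using hE
  let E : ℕ → List α := fun a => factor (X ((n + 8) * a)) (e a) (en ((n + 8) * a) (e a))
  have hmaps : ∀ a ∈ Finset.range (2 * S.card + 1), E a ∈ S := fun a ha => by
    have hi := hidx a ha
    have hb := h.G_lt ((n + 8) * a) (by omega)
    have hbR := hR ((n + 8) * a + n) (by omega)
    have h1 := he1 a ha
    have h2 := he2 a ha
    have := (htile ((n + 8) * a) (by omega)).mem (e a) (by omega) (by omega)
    rwa [he3 a ha] at this
  obtain ⟨u, -, hu⟩ := Finset.exists_lt_card_fiber_of_mul_lt_card_of_maps_to (n := 2) hmaps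
    (by rw [Finset.card_range]; omega)
  obtain ⟨x, hxm, hxlt⟩ := exists_increasing (f := fun a : ℕ => a) (m := 3)
    (fun _ _ _ _ hab => hab) (by omega) hu
  have h01 : x 0 + 1 ≤ x 1 := hxlt 0 1 (by omega) (by omega)
  have h12 : x 1 + 1 ≤ x 2 := hxlt 1 2 (by omega) (by omega)
  have h01' := Nat.mul_le_mul_left (n + 8) h01
  have h12' := Nat.mul_le_mul_left (n + 8) h12
  rw [mul_add] at h01' h12'
  obtain ⟨hx0, hu0⟩ := Finset.mem_filter.1 (hxm 0 (by omega))
  obtain ⟨hx1, hu1⟩ := Finset.mem_filter.1 (hxm 1 (by omega))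
  obtain ⟨hx2, hu2⟩ := Finset.mem_filter.1 (hxm 2 (by omega))
  have i0 := hidx _ hx0
  have i1 := hidx _ hx1
  have i2 := hidx _ hx2
  have p0 := he1 _ hx0
  have p1 := he1 _ hx1
  have q0 := he2 _ hx0
  have q1 := he2 _ hx1
  have r1 := he4 _ hx1
  have r2 := he4 _ hx2
  have r0 := he4 _ hx0
  have g0 := h.G_lt ((n + 8) * x 0) (by omega)
  have g1 := h.G_lt ((n + 8) * x 0 + 1) (by omega)
  have g2 := h.G_lt ((n + 8) * x 1 + 1) (by omega)
  have g3 := h.G_lt ((n + 8) * x 2 + 1) (by omega)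
  have l1 := h.le_of_le (show (n + 8) * x 0 + n ≤ (n + 8) * x 1 by omega) (by omega)
  obtain ⟨f1, f2⟩ := (factor_eq_iff (by omega) (by omega)).1 (hu0.trans hu1.symm)
  obtain ⟨f3, -⟩ := (factor_eq_iff (by omega) (by omega)).1 (hu1.trans hu2.symm)
  have big := h.eight_mul_lt (i := (n + 8) * x 1 + n + 3) (j := (n + 8) * x 2 + 1)
    (by omega) (by omega)
  have g4 := h.G_lt ((n + 8) * x 1 + n + 3) (by omega)
  have := h.lt_of_repeats (i := (n + 8) * x 1 + n) (by omega) (e := e (x 0)) (e' := e (x 1))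
    (n := en ((n + 8) * x 0) (e (x 0)) - e (x 0)) (by omega) (by omega) (by omega)
    fun q hq1 hq2 => by
      have := f2 (q - e (x 0)) (by omega) (by omega)
      rw [h.tail _ (by omega) ((n + 8) * x 0) (by omega) q (by omega),
        h.tail _ (by omega) ((n + 8) * x 1) (by omega) (q + (e (x 1) - e (x 0))) (by omega)]
      convert! this using 2 <;> ring
  omega

/-- The common word of the ladder ends with the part of the right half tiled by short words in
`exists_short`. Hence the configurations on the rungs between see this tiling around the
origin. -/
theorem Ladder.exists_tiles {v R : ℤ} {m n : ℕ} {X : ℕ → Config α} {b : ℕ → ℤ}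
    (h : Ladder D G v m X b) {S : Finset (List α)} {st en : ℤ → ℤ} {i j : ℕ}
    (htile : Tiles S (X i) (-R) R st en) (hl : i + n < m) (hR : b (i + n) < R)
    (hcut : st (b i) = b i) (hij : i < j) (hj : j + 2 ≤ i + n)
    (hshort : ∀ e, b i ≤ e → e < b (i + n) → st e = e → 5 * (en e - e) ≤ b (i + 1)) :
    ∃ st' en', Tiles (S.filter fun u => 5 * (u.length : ℤ) ≤ b (i + 1)) (X j)
      (-(b (i + 1) - b (i + 1) / 5)) (b (i + 1) - b (i + 1) / 5) st' en' := by
  have hG := h.G_pos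
  have hbi := h.G_lt i (by omega)
  have hbl := h.add_D_lt (i + n) hl
  have hD := h.D_pos
  have hb1 := h.le_of_le (show i ≤ i + 1 by omega) (by omega)
  have hbj := h.le_of_le (show i + 1 ≤ j by omega) (by omega)
  have hjl := h.add_lt (show j < i + n - 1 by omega) (show i + n - 1 < i + n by omega) hl
  have hil := h.add_lt (show i < j by omega) (show j < i + n - 1 by omega) (by omega)
  -- the last cut of the tiling of `X i` before `b (i + n)`
  have hc1 := htile.st_le (b (i + n)) (by omega) hR
  have hc2 := htile.lt_en (b (i + n)) (by omega) hR
  have hc3 := htile.le_st hcut (q := b (i + n)) (by omega) hR (by omega)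
  have hc4 := htile.st_st (q := b (i + n)) (by omega) hR
  have hc5 := htile.en_st (q := b (i + n)) (by omega) hR
  -- It is at distance at most `b (i + 1) / 5` from `b (i + n)`, since the word starting there is
  -- short. This is what the window loses on the right.
  have hc6 : b (i + n) - st (b (i + n)) ≤ b (i + 1) / 5 := by
    by_cases hlt : st (b (i + n)) < b (i + n)
    · have := hshort _ hc3 hlt hc4
      omega
    · omega
  set c := st (b (i + n)) with hc
  -- the translation from the common word in `X j` to the one in `X (i + n)`, whose end lies in the
  -- common right half and is tiled there as in `X i`
  set s := b (i + n) - b j with hs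
  have key : ∀ q, -(b (i + 1) - b (i + 1) / 5) ≤ q → q < b (i + 1) - b (i + 1) / 5 →
      b i ≤ st (q + s) ∧ st (q + s) ≤ q + s ∧ q + s < en (q + s) ∧ en (q + s) ≤ c ∧
      -R ≤ q + s ∧ q + s < R := fun q h1 h2 => by
    have hA : -R ≤ q + s := by omega
    have hB : q + s < R := by omega
    exact ⟨htile.le_st hcut hA hB (by omega), htile.st_le _ hA hB, htile.lt_en _ hA hB,
      htile.en_le hc4 hA hB (by omega), hA, hB⟩
  refine ⟨fun q => st (q + s) - s, fun q => en (q + s) - s, ?_, ?_, ?_, ?_, ?_⟩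
  · intro q h1 h2
    have := key q h1 h2
    omega
  · intro q h1 h2
    have := key q h1 h2
    omega
  · intro q h1 h2
    obtain ⟨k1, k2, k3, k4, k5, k6⟩ := key q h1 h2
    have heq : factor (X j) (st (q + s) - s) (en (q + s) - s) =
        factor (X i) (st (q + s)) (en (q + s)) := by
      refine (factor_eq_iff (by omega) (by omega)).2 ⟨by omega, fun r hr1 hr2 => ?_⟩
      rw [h.tail i (by omega) (i + n) hl _ (by omega)]
      have := h.suffix j (by omega) (i + n) hl (st (q + s) + r - b (i + n)) (by omega) (by omega)
      convert! this using 2 <;> omega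
    rw [heq]
    refine Finset.mem_filter.2 ⟨htile.mem _ k5 k6, ?_⟩
    have e1 := htile.en_sub_st k5 k6
    have e2 := hshort _ k1 (by omega) (htile.st_st k5 k6)
    rw [htile.en_st k5 k6] at e2
    omega
  · intro q h1 h2 r hr1 hr2
    obtain ⟨k1, k2, k3, k4, k5, k6⟩ := key q h1 h2
    simp only [htile.st_eq _ k5 k6 (r + s) (by omega) (by omega)]
  · intro q h1 h2 r hr1 hr2
    obtain ⟨k1, k2, k3, k4, k5, k6⟩ := key q h1 h2
    simp only [htile.en_eq _ k5 k6 (r + s) (by omega) (by omega)]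

/-- Configurations in which one and the same word `V` covers `[-D, G]` form a ladder. -/
theorem exists_ladder {T : Finset (Config α)} {V : List α} {st en : Config α → ℤ → ℤ}
    (h : Asymptotic D G L T)
    (hV : ∀ x ∈ T, factor x (st x 0) (en x 0) = V)
    (hst : ∀ x ∈ T, st x 0 < -D) (hen : ∀ x ∈ T, G < en x 0) {m : ℕ} (hm0 : 0 < m)
    (hm : m ≤ T.card) :
    ∃ X : ℕ → Config α, (∀ i < m, X i ∈ T) ∧
      Ladder D G V.length m X (fun i => en (X i) 0) := by
  have hD := h.D_pos
  have hG := h.G_pos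
  have hlen : ∀ x ∈ T, en x 0 - st x 0 = V.length := fun x hx => by
    have h1 := hst x hx
    have h2 := hen x hx
    rw [← hV x hx, factor_length]
    omega
  have hsuf : ∀ x ∈ T, ∀ y ∈ T, ∀ q, -(V.length : ℤ) ≤ q → q < 0 →
      x (en x 0 + q) = y (en y 0 + q) := fun x hx y hy q hq1 hq2 => by
    have h1 := hlen x hx
    have h2 := hlen y hy
    have := ((factor_eq_iff (by omega) (by omega)).1 ((hV x hx).trans (hV y hy).symm)).2
      (q + V.length) (by omega) (by omega)
    convert! this using 2 <;> omega
  obtain ⟨X, hXT, hX⟩ := exists_increasing (f := fun x => en x 0) (T := T) (fun x hx y hy hxy => by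
    have hx : x ∈ T := hx
    have hy : y ∈ T := hy
    have hxy : en x 0 = en y 0 := hxy
    refine h.distinct x hx y hy fun q hq1 hq2 => ?_
    have h1 := hlen x hx
    have h2 := hst x hx
    have h3 := hen x hx
    have := hsuf x hx y hy (q - en x 0) (by omega) (by omega)
    convert! this using 2 <;> omega) hm0 hm
  refine ⟨X, hXT, hD, hG, fun i hi j hj => h.tail _ (hXT i hi) _ (hXT j hj),
    fun i hi j hj hij => ?_, fun i hi j hj => hsuf _ (hXT i hi) _ (hXT j hj), hX,
    fun i hi => hen _ (hXT i hi), fun i hi => ?_, fun i hi => h.repeats_lt _ (hXT i hi)⟩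
  · have heq := h.distinct _ (hXT i hi) _ (hXT j hj) hij
    rcases lt_trichotomy i j with hlt | hlt | hlt
    · exact absurd (hX i j hlt hj) (by rw [heq]; exact lt_irrefl _)
    · exact hlt
    · exact absurd (hX j i hlt hi) (by rw [heq]; exact lt_irrefl _)
  · have h1 := hlen _ (hXT i hi)
    have h2 := hst _ (hXT i hi)
    omega

/-- A bound for the number of asymptotic configurations tiled by at most `k` words. For `k + 1` words,
the square bounds the number of configurations with a cut close to the origin, and the second
summand the number of the others: `k + 1` choices for the word covering the origin, times a number
of rungs for which `Ladder.exists_short` gives more than `asymptoticBound k` rungs to which the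
induction hypothesis applies. -/
def asymptoticBound : ℕ → ℕ
  | 0 => 0
  | k + 1 => (k + 1) ^ 2 + (k + 1) * ((2 * (k + 1) + 1) * (asymptoticBound k + 11))

/-- Right asymptotic configurations which are tiled by at most `k` long words around the origin are
bounded in number by `k` alone. The induction replaces the tilings by tilings with fewer words, on
a smaller window and for a smaller family. -/
theorem card_le_asymptoticBound (k : ℕ) : ∀ (T : Finset (Config α)) (S : Finset (List α)) (R : ℤ),
    S.card ≤ k → (∀ u ∈ S, L ≤ u.length) → Asymptotic D G L T → 0 < R →
    (∀ u ∈ S, 4 * (u.length : ℤ) ≤ R) → (∀ x ∈ T, ∃ st en, Tiles S x (-R) R st en) →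
    T.card ≤ asymptoticBound k := by
  classical
  induction k with
  | zero =>
    intro T S R hS hL h hR hSR htile
    rw [Nat.le_zero, Finset.card_eq_zero] at hS
    subst hS
    rcases T.eq_empty_or_nonempty with rfl | ⟨x, hx⟩
    · simp
    · obtain ⟨st, en, ht⟩ := htile x hx
      exact absurd (ht.mem 0 (by omega) hR) (by simp)
  | succ k ih =>
    intro T S R hS hL h hR hSR htile
    by_contra hcard
    rw [not_le, asymptoticBound] at hcard
    have hD := h.D_pos
    have hG := h.G_pos
    have hDG := h.lt_L
    choose! st en htile using htile
    set m := (2 * (k + 1) + 1) * (asymptoticBound k + 11) with hm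
    have hTne : T.Nonempty := Finset.card_pos.1 (by omega)
    obtain ⟨x₀, hx₀⟩ := hTne
    have hRL : 4 * L ≤ R := by
      have h1 := (htile x₀ hx₀).mem 0 (by omega) hR
      have h2 := hL _ h1
      have h3 := hSR _ h1
      omega
    -- discard the configurations with a cut close to the origin
    have hcut := card_le_of_cut (T := T.filter fun x => ∃ c, -D ≤ c ∧ c ≤ G ∧ st x c = c)
      (h.mono (Finset.filter_subset _ _)) hL (R := R) (by omega)
      (fun x hx => htile x (Finset.mem_filter.1 hx).1) (fun x hx => (Finset.mem_filter.1 hx).2)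
    have hsum := T.card_filter_add_card_filter_not (fun x => ∃ c, -D ≤ c ∧ c ≤ G ∧ st x c = c)
    set T₁ := T.filter fun x => ¬∃ c, -D ≤ c ∧ c ≤ G ∧ st x c = c with hT₁
    have hS2 : S.card ^ 2 ≤ (k + 1) ^ 2 := Nat.pow_le_pow_left hS 2
    have hSm : S.card * m ≤ (k + 1) * m := Nat.mul_le_mul_right m hS
    -- group the others according to the word which covers the origin
    obtain ⟨V, hVS, hV⟩ := Finset.exists_lt_card_fiber_of_mul_lt_card_of_maps_to
      (s := T₁) (t := S) (n := m) (f := fun x => factor x (st x 0) (en x 0))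
      (fun x hx => (htile x (Finset.mem_filter.1 hx).1).mem 0 (by omega) hR) (by omega)
    set T₂ := T₁.filter fun x => factor x (st x 0) (en x 0) = V with hT₂
    have hsub : T₂ ⊆ T := (Finset.filter_subset _ _).trans (Finset.filter_subset _ _)
    have hm0 : 0 < m := by positivity
    have hVR := hSR V hVS
    have hno : ∀ x ∈ T₂, ∀ c, -D ≤ c → c ≤ G → st x c ≠ c := fun x hx c h1 h2 h3 =>
      (Finset.mem_filter.1 (Finset.mem_filter.1 hx).1).2 ⟨c, h1, h2, h3⟩
    have hfac : ∀ x ∈ T₂, factor x (st x 0) (en x 0) = V := fun x hx => (Finset.mem_filter.1 hx).2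
    have hst : ∀ x ∈ T₂, st x 0 < -D := fun x hx => by
      have t := htile x (hsub hx)
      by_contra hge
      exact hno x hx _ (not_lt.1 hge) ((t.st_le 0 (by omega) hR).trans hG.le)
        (t.st_st (by omega) hR)
    have hcutb : ∀ x ∈ T₂, st x (en x 0) = en x 0 := fun x hx => by
      have t := htile x (hsub hx)
      have h1 := t.lt_en 0 (by omega) hR
      have h2 := t.en_sub_st (q := 0) (by omega) hR
      rw [hfac x hx] at h2
      have h3 := hst x hx
      exact t.st_en (by omega) hR (by omega) (by omega)
    have hen : ∀ x ∈ T₂, G < en x 0 := fun x hx => by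
      have t := htile x (hsub hx)
      have h1 := t.lt_en 0 (by omega) hR
      by_contra hle
      exact hno x hx _ (by omega) (not_lt.1 hle) (hcutb x hx)
    obtain ⟨X, hXT, hlad⟩ := exists_ladder (h.mono hsub) hfac hst hen hm0 hV.le
    have hvR : ∀ i < m, en (X i) 0 < R := fun i hi => by
      have := hlad.add_D_lt i hi
      omega
    obtain ⟨i, hi, hshort⟩ := hlad.exists_short (n := asymptoticBound k + 3) (S := S)
      (st := fun i => st (X i)) (en := fun i => en (X i)) (R := R)
      (fun i hi => htile _ (hsub (hXT i hi))) hvR (by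
        rw [hm]
        exact Nat.mul_le_mul_right _ (by omega))
    -- the rungs above the `i`-th one are tiled by the short words of `S`
    set b : ℕ → ℤ := fun i => en (X i) 0 with hb
    have hb1 : G < b (i + 1) := hlad.G_lt (i + 1) (by omega)
    have hbv : b (i + 1) + D < V.length := hlad.add_D_lt (i + 1) (by omega)
    have hle := ih ((Finset.Ico (i + 1) (i + asymptoticBound k + 2)).image X)
      (S.filter fun u => 5 * (u.length : ℤ) ≤ b (i + 1)) (b (i + 1) - b (i + 1) / 5) ?_ ?_ ?_ ?_ ?_ ?_
    · rw [Finset.card_image_of_injOn, Nat.card_Ico] at hle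
      · omega
      · intro a ha c hc hac
        have ha := Finset.mem_Ico.1 ha
        have hc := Finset.mem_Ico.1 hc
        exact hlad.distinct a (by omega) c (by omega) fun q _ _ => by rw [hac]
    · have hss : (S.filter fun u => 5 * (u.length : ℤ) ≤ b (i + 1)) ⊂ S :=
        Finset.filter_ssubset.2 ⟨V, hVS, by omega⟩
      have := Finset.card_lt_card hss
      omega
    · exact fun u hu => hL u (Finset.mem_filter.1 hu).1
    · refine h.mono fun x hx => ?_
      obtain ⟨a, ha, rfl⟩ := Finset.mem_image.1 hx
      have ha := Finset.mem_Ico.1 ha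
      exact hsub (hXT a (by omega))
    · omega
    · intro u hu
      have := (Finset.mem_filter.1 hu).2
      omega
    · intro x hx
      obtain ⟨a, ha, rfl⟩ := Finset.mem_image.1 hx
      have ha := Finset.mem_Ico.1 ha
      exact hlad.exists_tiles (htile _ (hsub (hXT i (by omega)))) hi (hvR _ hi)
        (hcutb _ (hXT i (by omega))) (by omega) (by omega) hshort

end Asymptotic

/-! ### Desubstitutions -/

theorem add_le_of_strictMono {k : ℤ → ℤ} (hk : StrictMono k) {a b : ℤ} (hab : a ≤ b) :
    k a + (b - a) ≤ k b := by
  induction b, hab using Int.leInduction with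
  | base => simp
  | succ n _ ih =>
    have := hk (show n < n + 1 by omega)
    omega

theorem exists_le_lt_of_strictMono {k : ℤ → ℤ} (hk : StrictMono k) (n : ℤ) :
    ∃ s, k s ≤ n ∧ n < k (s + 1) := by
  obtain ⟨s, hs, hmax⟩ := Int.exists_greatest_of_bdd (P := fun s => k s ≤ n)
    ⟨max 0 (n - k 0), fun z hz => by
      by_contra hlt
      have := add_le_of_strictMono hk (show (0 : ℤ) ≤ z by omega)
      omega⟩
    ⟨min 0 (n - k 0), by
      have := add_le_of_strictMono hk (show min 0 (n - k 0) ≤ 0 by omega)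
      omega⟩
  refine ⟨s, hs, ?_⟩
  by_contra hle
  have := hmax (s + 1) (by omega)
  omega

theorem eq_of_le_lt {k : ℤ → ℤ} (hk : StrictMono k) {n s s' : ℤ} (h1 : k s ≤ n)
    (h2 : n < k (s + 1)) (h3 : k s' ≤ n) (h4 : n < k (s' + 1)) : s = s' := by
  have e1 := hk.lt_iff_lt.1 (h1.trans_lt h4)
  have e2 := hk.lt_iff_lt.1 (h3.trans_lt h2)
  omega

namespace Substitution

variable {B C : Type*} {τ : Substitution B C} {x : Config C} {k : ℤ → ℤ} {y : Config B}

theorem isStandard_iff (hk : StrictMono k) : IsStandard k ↔ k 0 ≤ 0 ∧ 0 < k 1 := by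
  constructor
  · intro h
    refine ⟨h.1, ?_⟩
    by_contra hle
    have : (1 : ℤ) ≤ 0 := h.2 (show k 1 ≤ 0 by omega)
    omega
  · rintro ⟨h0, h1⟩
    refine ⟨h0, fun s (hs : k s ≤ 0) => ?_⟩
    have := hk.lt_iff_lt.1 (hs.trans_lt h1)
    omega

theorem IsDesubstitution.sub_eq (h : τ.IsDesubstitution x k y) (s : ℤ) :
    k (s + 1) - k s = (τ.word (y s)).length := by
  have := h.1 (show s < s + 1 by omega)
  rw [← h.2 s, factor_length]
  omega

theorem IsDesubstitution.shift_by (h : τ.IsDesubstitution x k y) (a : ℤ) :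
    τ.IsDesubstitution (fun q => x (q + a)) (fun s => k s - a) y := by
  refine ⟨fun s t hst => sub_lt_sub_right (h.1 hst) a, fun s => ?_⟩
  have := h.1 (show s < s + 1 by omega)
  rw [← h.2 s, factor_eq_iff (sub_le_sub_right this.le a) this.le]
  exact ⟨sub_sub_sub_cancel_right _ _ a, fun n _ _ => congrArg x (by ring)⟩

theorem IsDesubstitution.reindex (h : τ.IsDesubstitution x k y) (a : ℤ) :
    τ.IsDesubstitution x (fun s => k (s + a)) (fun s => y (s + a)) := by
  refine ⟨fun s t hst => h.1 (by omega), fun s => ?_⟩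
  rw [← h.2 (s + a), add_right_comm]

theorem IsDesubstitution.exists_standard (h : τ.IsDesubstitution x k y) :
    ∃ a, IsStandard fun s => k (s + a) := by
  obtain ⟨a, ha⟩ := exists_le_lt_of_strictMono h.1 0
  refine ⟨a, (isStandard_iff (h.reindex a).1).2 ?_⟩
  simpa [add_comm] using ha

theorem shift_by_mem_image (hx : x ∈ τ.image) (a : ℤ) : (fun q => x (q + a)) ∈ τ.image := by
  obtain ⟨k, y, h⟩ := hx
  exact ⟨_, _, h.shift_by a⟩

theorem minLength_le (τ : Substitution B C) (b : B) : τ.minLength ≤ (τ.word b).length :=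
  ciInf_le (OrderBot.bddBelow _) b

theorem IsDesubstitution.exists_tiles [Fintype B] [DecidableEq (List C)]
    (h : τ.IsDesubstitution x k y) (A A' : ℤ) :
    ∃ st en, Tiles (Finset.univ.image τ.word) x A A' st en := by
  choose s hs1 hs2 using exists_le_lt_of_strictMono h.1
  refine ⟨fun q => k (s q), fun q => k (s q + 1), fun q _ _ => hs1 q, fun q _ _ => hs2 q,
    fun q _ _ => ?_, fun q _ _ r h1 h2 => ?_, fun q _ _ r h1 h2 => ?_⟩
  · rw [h.2]
    exact Finset.mem_image_of_mem _ (Finset.mem_univ _)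
  · simp only [eq_of_le_lt h.1 (hs1 r) (hs2 r) h1 h2]
  · simp only [eq_of_le_lt h.1 (hs1 r) (hs2 r) h1 h2]

end Substitution

/-! ### Compactness of the limit set -/

open Filter

theorem exists_eventually_eq {ι β : Type*} (U : Ultrafilter ι) {F : Set β} (hF : F.Finite)
    {f : ι → β} (hf : ∀ i, f i ∈ F) : ∃ b, ∀ᶠ i in U, f i = b := by
  have := (U.finite_biUnion_mem_iff (s := fun b => {i | f i = b}) hF).1 (by
    have : (⋃ b ∈ F, {i | f i = b}) = Set.univ := by
      ext i
      simpa using hf i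
    rw [this]
    exact univ_mem)
  obtain ⟨b, -, hb⟩ := this
  exact ⟨b, hb⟩

/-- The image of a substitution between finite alphabets is closed under pointwise limits, as the
schemes of the approximating points, once standard, have bounded entries. -/
theorem Substitution.mem_image_of_eventually {B C ι : Type*} [Finite B] (τ : Substitution B C)
    (U : Ultrafilter ι) {z : ι → Config C} (hz : ∀ i, z i ∈ τ.image) {x : Config C}
    (hx : ∀ q, ∀ᶠ i in U, z i q = x q) : x ∈ τ.image := by
  have hex : ∀ i, ∃ k y, τ.IsDesubstitution (z i) k y ∧ k 0 ≤ 0 ∧ 0 < k 1 := fun i => by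
    obtain ⟨k, y, h⟩ := hz i
    obtain ⟨a, ha⟩ := h.exists_standard
    exact ⟨_, _, h.reindex a, (isStandard_iff (h.reindex a).1).1 ha⟩
  choose k y hd hk0 hk1 using hex
  have hy : ∀ s, ∃ b, ∀ᶠ i in U, y i s = b := fun s =>
    exists_eventually_eq U Set.finite_univ fun _ => Set.mem_univ _
  choose y' hy' using hy
  have hstep : ∀ s, ∀ᶠ i in U, k i (s + 1) = k i s + (τ.word (y' s)).length := fun s => by
    filter_upwards [hy' s] with i hi
    have := (hd i).sub_eq s
    rw [hi] at this
    omega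
  have hk : ∀ s, ∃ c, ∀ᶠ i in U, k i s = c := by
    intro s
    induction s using Int.induction_on with
    | zero =>
      refine exists_eventually_eq U
        (F := ((fun b => Set.Icc (-((τ.word b).length : ℤ)) 0) '' Set.univ).sUnion) ?_ fun i => ?_
      · refine Set.Finite.sUnion (Set.finite_univ.image _) ?_
        rintro _ ⟨b, -, rfl⟩
        exact Set.finite_Icc _ _
      · refine ⟨_, ⟨y i 0, Set.mem_univ _, rfl⟩, ?_⟩
        have h1 := (hd i).sub_eq 0
        have h2 := hk0 i
        have h3 := hk1 i
        rw [zero_add] at h1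
        simp only [Set.mem_Icc]
        omega
    | succ s ih =>
      obtain ⟨c, hc⟩ := ih
      refine ⟨c + (τ.word (y' s)).length, ?_⟩
      filter_upwards [hc, hstep s] with i h1 h2
      rw [h2, h1]
    | pred s ih =>
      obtain ⟨c, hc⟩ := ih
      refine ⟨c - (τ.word (y' (-s - 1))).length, ?_⟩
      filter_upwards [hc, hstep (-s - 1)] with i h1 h2
      rw [sub_add_cancel, h1] at h2
      omega
  choose k' hk' using hk
  refine ⟨k', y', fun a b hab => ?_, fun s => ?_⟩
  · obtain ⟨i, h1, h2⟩ := ((hk' a).and (hk' b)).exists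
    rw [← h1, ← h2]
    exact (hd i).1 hab
  · have hagree : ∀ᶠ i in U, ∀ q ∈ Finset.Ico (k' s) (k' (s + 1)), z i q = x q :=
      (Finset.eventually_all _).2 fun q _ => hx q
    obtain ⟨i, h1, h2, h3, h4⟩ :=
      ((hk' s).and ((hk' (s + 1)).and ((hy' s).and hagree))).exists
    have hlt := (hd i).1 (show s < s + 1 by omega)
    rw [h1, h2] at hlt
    rw [← h3, ← (hd i).2 s, h1, h2, factor_eq_iff hlt.le hlt.le]
    exact ⟨rfl, fun n hn1 hn2 => (h4 _ (Finset.mem_Ico.2 ⟨by omega, by omega⟩)).symm⟩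

namespace DirectiveSequence

variable {S : Type*} {τ : DirectiveSequence S}

theorem shift_by_mem_limitSet {x : Config (τ.alphabet 0)} (hx : x ∈ τ.limitSet) (a : ℤ) :
    (fun q => x (q + a)) ∈ τ.limitSet := by
  simp only [limitSet, Set.mem_iInter] at hx ⊢
  exact fun t => (τ.composed t).shift_by_mem_image (hx t) a

theorem exists_limit {ι : Type*} (U : Ultrafilter ι) {z : ι → Config (τ.alphabet 0)}
    (hz : ∀ i, z i ∈ τ.limitSet) : ∃ x ∈ τ.limitSet, ∀ q, ∀ᶠ i in U, z i q = x q := by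
  have : ∀ q, ∃ c, ∀ᶠ i in U, z i q = c := fun q =>
    exists_eventually_eq U Set.finite_univ fun _ => Set.mem_univ _
  choose x hx using this
  refine ⟨x, ?_, hx⟩
  simp only [limitSet, Set.mem_iInter] at hz ⊢
  exact fun t => (τ.composed t).mem_image_of_eventually U (fun i => hz i t) hx

theorem shiftMap_iterate (n : ℕ) (x : τ.limitSet) (q : ℤ) :
    (τ.shiftMap^[n] x).1 q = x.1 (q + n) := by
  induction n generalizing x with
  | zero => simp
  | succ n ih =>
    rw [Function.iterate_succ_apply, ih]
    exact congrArg x.1 (by push_cast; ring)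

theorem not_periodic (hap : Aperiodic τ.shiftMap) {x : Config (τ.alphabet 0)}
    (hx : x ∈ τ.limitSet) {p : ℤ} (hp : 0 < p) : ¬ ∀ q, x q = x (q + p) := by
  intro h
  have : (⟨x, hx⟩ : τ.limitSet) ∈ Function.periodicPts τ.shiftMap := by
    refine ⟨p.toNat, by omega, Subtype.ext (funext fun q => ?_)⟩
    rw [shiftMap_iterate, show ((p.toNat : ℕ) : ℤ) = p by omega]
    exact (h q).symm
  rw [show Function.periodicPts τ.shiftMap = ∅ from hap] at this
  exact this

/-- In an aperiodic limit set, stretches with a bounded period have bounded length: otherwise,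
a limit of longer and longer ones would be a periodic point. -/
theorem exists_repeats_lt (hap : Aperiodic τ.shiftMap) (P : ℤ) :
    ∃ G : ℤ, 0 < G ∧ ∀ x ∈ τ.limitSet, ∀ a c p, 0 < p → p ≤ P → Repeats x a c p → c - a < G := by
  by_contra hcon
  push Not at hcon
  have := fun n : ℕ => hcon (2 * n + 1) (by omega)
  choose x hx a c p hp hpP hrep hac using this
  let U : Ultrafilter ℕ := hyperfilter ℕ
  obtain ⟨y, hy, hlim⟩ := exists_limit U fun n => shift_by_mem_limitSet (hx n) (a n + n)
  obtain ⟨p', hp'⟩ := exists_eventually_eq U (Set.finite_Icc 1 P) (f := p)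
    fun n => ⟨hp n, hpP n⟩
  obtain ⟨n₀, hn₀⟩ := hp'.exists
  refine not_periodic hap hy (p := p') (by rw [← hn₀]; exact hp n₀) fun q => ?_
  have hbig : ∀ᶠ n in U, q.natAbs < n :=
    (Nat.hyperfilter_le_atTop) (eventually_gt_atTop q.natAbs)
  obtain ⟨n, h1, h2, h3, h4⟩ := ((hlim q).and ((hlim (q + p')).and (hp'.and hbig))).exists
  rw [← h1, ← h2, hrep n (q + (a n + n)) (by omega) (by have := hac n; omega), h3]
  exact congrArg (x n) (by ring)

/-- Points of the limit set which are close for a compatible metric agree at the origin. -/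
theorem exists_dist_lt (d : MetricSpace τ.limitSet)
    (hd : d.toUniformSpace.toTopologicalSpace = τ.limitTopology) :
    ∃ ε : ℝ, 0 < ε ∧ ∀ x y : τ.limitSet, dist x y < ε → x.1 0 = y.1 0 := by
  by_contra hcon
  push Not at hcon
  have := fun n : ℕ => hcon (1 / ((n : ℝ) + 1)) (by positivity)
  choose x y hxy hne using this
  let U : Ultrafilter ℕ := hyperfilter ℕ
  have htend : ∀ (z : ℕ → τ.limitSet) (w : τ.limitSet), (∀ q, ∀ᶠ n in U, (z n).1 q = w.1 q) →
      Tendsto z U (nhds w) := by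
    intro z w h
    rw [hd]
    let : TopologicalSpace (τ.alphabet 0) := ⊥
    have : DiscreteTopology (τ.alphabet 0) := ⟨rfl⟩
    rw [nhds_induced, tendsto_comap_iff, tendsto_pi_nhds]
    intro q
    rw [nhds_discrete, tendsto_pure]
    exact h q
  obtain ⟨x', hx', hxl⟩ := exists_limit U fun n => (x n).2
  obtain ⟨y', hy', hyl⟩ := exists_limit U fun n => (y n).2
  have hx := htend x ⟨x', hx'⟩ hxl
  have hy := htend y ⟨y', hy'⟩ hyl
  have h0 : Tendsto (fun n => dist (x n) (y n)) U (nhds 0) :=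
    squeeze_zero (fun _ => dist_nonneg) (fun n => (hxy n).le)
      (tendsto_one_div_add_atTop_nhds_zero_nat.mono_left Nat.hyperfilter_le_atTop)
  have heq := dist_eq_zero.1 (tendsto_nhds_unique (hx.dist hy) h0)
  obtain ⟨n, h1, h2⟩ := ((hxl 0).and (hyl 0)).exists
  exact hne n (by rw [h1, h2, Subtype.mk.inj heq])

end DirectiveSequence

/-! ### Recognizability and periodic points -/

theorem exists_partial_sums (l : ℤ → ℤ) : ∃ j : ℤ → ℤ, ∀ s, j (s + 1) = j s + l s := by
  refine ⟨fun s => Int.inductionOn' s 0 0 (fun k _ v => v + l k) (fun k _ v => v - l (k - 1)),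
    fun s => ?_⟩
  rcases le_or_gt 0 s with hs | hs
  · simp only [Int.inductionOn'_add_one hs]
  · have := Int.inductionOn'_sub_one (motive := fun _ => ℤ) (zero := 0)
      (succ := fun k _ v => v + l k) (pred := fun k _ v => v - l (k - 1))
      (show s + 1 ≤ 0 by omega)
    simp only [add_sub_cancel_right] at this ⊢
    rw [this, sub_add_cancel]

namespace Substitution

variable {A B C : Type*}

/-- A desubstitution for a composition factors through an intermediate configuration. -/
theorem IsDesubstitution.exists_of_comp {τ : Substitution B A} {τ' : Substitution C B}
    {x : Config A} {k : ℤ → ℤ} {y : Config C} (h : (τ.comp τ').IsDesubstitution x k y) :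
    ∃ k' z j, τ.IsDesubstitution x k' z ∧ τ'.IsDesubstitution z j y ∧ ∀ s, k s = k' (j s) := by
  obtain ⟨j, hj⟩ := exists_partial_sums fun s => (τ'.word (y s)).length
  have hjlt : ∀ s, j s < j (s + 1) := fun s => by
    have := List.length_pos_iff.2 (τ'.word_ne_nil (y s))
    rw [hj]
    omega
  have hjm : StrictMono j := strictMono_int_of_lt_succ hjlt
  choose s hs1 hs2 using exists_le_lt_of_strictMono hjm
  have hz : ∀ n, ∃ c, (τ'.word (y (s n)))[(n - j (s n)).toNat]? = some c := fun n => by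
    have h1 := hs1 n
    have h2 := hs2 n
    rw [hj] at h2
    exact ⟨_, List.getElem?_eq_getElem (by omega)⟩
  choose z hz using hz
  let pre : ℤ → ℤ → List A := fun r n => ((τ'.word (y r)).take (n - j r).toNat).flatMap τ.word
  let k' : ℤ → ℤ := fun n => k (s n) + (pre (s n) n).length
  have hword : ∀ r, factor x (k r) (k (r + 1)) = (τ'.word (y r)).flatMap τ.word := h.2
  have hkj : ∀ r, k' (j r) = k r := fun r => by
    have : s (j r) = r := eq_of_le_lt hjm (hs1 _) (hs2 _) le_rfl (hjlt r)
    simp [k', pre, this]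
  have hpre : ∀ n, pre (s n) (n + 1) = pre (s n) n ++ τ.word (z n) := fun n => by
    have h1 := hs1 n
    simp only [pre]
    rw [show (n + 1 - j (s n)).toNat = (n - j (s n)).toNat + 1 by omega, List.take_add_one, hz]
    simp
  have hsucc : ∀ n, k' (n + 1) = k (s n) + (pre (s n) (n + 1)).length := fun n => by
    rcases (show n + 1 ≤ j (s n + 1) from hs2 n).lt_or_eq with hlt | heq
    · have : s (n + 1) = s n :=
        eq_of_le_lt hjm (hs1 _) (hs2 _) ((hs1 n).trans (by omega)) hlt
      simp only [k', this]
    · have h1 := h.sub_eq (s n)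
      have h2 := hj (s n)
      rw [heq, hkj]
      simp only [pre]
      rw [List.take_of_length_le (by omega)]
      simp only [comp] at h1
      omega
  have hstep : ∀ n, k' (n + 1) = k' n + (τ.word (z n)).length := fun n => by
    rw [hsucc, hpre, List.length_append]
    simp only [k']
    push_cast
    ring
  refine ⟨k', z, j, ⟨strictMono_int_of_lt_succ fun n => ?_, fun n => ?_⟩, ⟨hjm, fun r => ?_⟩,
    fun r => (hkj r).symm⟩
  · have := List.length_pos_iff.2 (τ.word_ne_nil (z n))
    rw [hstep]
    omega
  · have h1 : factor x (k (s n)) (k (s n + 1)) = pre (s n) n ++ τ.word (z n) ++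
        ((τ'.word (y (s n))).drop (n + 1 - j (s n)).toNat).flatMap τ.word := by
      rw [hword, ← hpre]
      simp only [pre]
      rw [← List.flatMap_append, List.take_append_drop]
    rw [hstep]
    exact factor_eq_of_append h1
  · refine List.ext_getElem? fun i => ?_
    have h2 := hj r
    rw [factor_getElem?]
    split_ifs with hi
    · have : s (j r + i) = r := eq_of_le_lt hjm (hs1 _) (hs2 _) (by omega) (by omega)
      have h3 := hz (j r + i)
      rw [this, add_sub_cancel_left, Int.toNat_natCast] at h3
      exact h3.symm
    · exact (List.getElem?_eq_none (by omega)).symm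

/-- Desubstituting a periodic configuration for a recognizable substitution gives a periodic
configuration, as the scheme is invariant under the period. -/
theorem IsDesubstitution.exists_period {τ : Substitution B A} (hinj : τ.Injective)
    (hrec : τ.QuasiRecognizable) {x : Config A} {k : ℤ → ℤ} {y : Config B}
    (h : τ.IsDesubstitution x k y) {p : ℤ} (hp : 0 < p) (hx : ∀ q, x q = x (q + p)) :
    ∃ r, 0 < r ∧ (∀ s, k (s + r) = k s + p) ∧ ∀ s, y s = y (s + r) := by
  have h' := h.shift_by p
  rw [show (fun q => x (q + p)) = x from funext fun q => (hx q).symm] at h'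
  obtain ⟨a, ha⟩ := h.exists_standard
  obtain ⟨b, hb⟩ := h'.exists_standard
  have heq := hrec x (Set.mem_univ x) _ _ ⟨_, h.reindex a⟩ ha ⟨_, h'.reindex b⟩ hb
  have hk : ∀ s, k (s + (b - a)) = k s + p := fun s => by
    have := congrFun heq (s - a)
    simp only [sub_add_cancel] at this
    rw [this, sub_add_cancel]
    exact congrArg k (by ring)
  refine ⟨b - a, ?_, hk, fun s => hinj ?_⟩
  · have := hk 0
    rw [zero_add] at this
    exact h.1.lt_iff_lt.1 (show k 0 < k (b - a) by omega)
  · have hlt := (h.1 (show s < s + 1 by omega)).le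
    rw [← h.2, ← h.2, add_right_comm, hk, hk, factor_eq_iff hlt (by omega)]
    refine ⟨by ring, fun n _ _ => ?_⟩
    rw [add_right_comm]
    exact hx _

end Substitution

namespace DirectiveSequence

variable {S : Type*} {τ : DirectiveSequence S}

theorem exists_period_composed (h : ∀ t, (τ.subst t).Injective ∧ (τ.subst t).QuasiRecognizable)
    {x : Config (τ.alphabet 0)} {p : ℤ} (hp : 0 < p) (hx : ∀ q, x q = x (q + p)) (t : ℕ) :
    ∀ k y, (τ.composed t).IsDesubstitution x k y →
      ∃ r, 0 < r ∧ (∀ s, k (s + r) = k s + p) ∧ ∀ s, y s = y (s + r) := by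
  induction t with
  | zero =>
    intro k y hd
    have hk : ∀ s, k (s + 1) = k s + 1 := fun s => by
      have : k (s + 1) - k s = ((1 : ℕ) : ℤ) := hd.sub_eq s
      omega
    have hkp : ∀ s (n : ℕ), k (s + n) = k s + n := fun s n => by
      induction n with
      | zero => simp
      | succ n ih =>
        push_cast
        rw [← add_assoc, hk, ih, add_assoc]
    have hy : ∀ s, y s = x (k s) := fun s => by
      have h1 : factor x (k s) (k (s + 1)) = [y s] := hd.2 s
      have h2 : (factor x (k s) (k (s + 1)))[0]? = [y s][0]? := by rw [h1]
      rw [factor_getElem?, if_pos (by have := hk s; omega)] at h2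
      simpa using h2.symm
    have hkp' : ∀ s, k (s + p) = k s + p := fun s => by
      have := hkp s p.toNat
      rwa [Int.toNat_of_nonneg hp.le] at this
    exact ⟨p, hp, hkp', fun s => by rw [hy, hy, hkp']; exact hx _⟩
  | succ t ih =>
    intro k y hd
    obtain ⟨k', z, j, h1, h2, hk⟩ := Substitution.IsDesubstitution.exists_of_comp hd
    obtain ⟨r, hr, hk', hz⟩ := ih k' z h1
    obtain ⟨r', hr', hj, hy⟩ := h2.exists_period (h t).1 (h t).2 hr hz
    exact ⟨r', hr', fun s => by rw [hk, hk, hj, hk'], hy⟩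

theorem aperiodic_of_recognizable
    (h : ∀ t, (τ.subst t).Injective ∧ (τ.subst t).QuasiRecognizable)
    (hlen : ∀ L : ℕ, ∃ t, L ≤ (τ.composed t).minLength) : Aperiodic τ.shiftMap := by
  refine Set.eq_empty_of_forall_notMem fun x hx => ?_
  obtain ⟨p, hp, hxp⟩ := hx
  have hper : ∀ q, x.1 q = x.1 (q + p) := fun q => by
    rw [← shiftMap_iterate]
    exact (congrFun (congrArg Subtype.val hxp) q).symm
  obtain ⟨t, ht⟩ := hlen (p + 1)
  obtain ⟨k, y, hd⟩ := Set.mem_iInter.1 x.2 t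
  obtain ⟨r, hr, hk, -⟩ := exists_period_composed h (by omega) hper t k y hd
  have h1 := hk 0
  have h2 := hd.sub_eq 0
  have h3 := (τ.composed t).minLength_le (y 0)
  have h4 := hd.1.monotone (show 0 + 1 ≤ 0 + r by omega)
  omega

end DirectiveSequence

/-! ### Finite positive expansivity -/

namespace DirectiveSequence

variable {S : Type*} {τ : DirectiveSequence S}

theorem Finitary.exists_card_alphabet_le (h : τ.Finitary) :
    ∃ K, ∀ t, (τ.alphabet (t + 1)).card ≤ K := by
  obtain ⟨K, hK⟩ := (h.image fun c => c.1.1.card).bddAbove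
  exact ⟨K, fun t => hK ⟨_, ⟨t, rfl⟩, rfl⟩⟩

theorem GrowsExponentially.exists_le_minLength (h : τ.GrowsExponentially) (L : ℕ) :
    ∃ t, L ≤ (τ.composed (t + 1)).minLength := by
  obtain ⟨c, hc, ρ, hρ, hle⟩ := h
  obtain ⟨t, ht⟩ := pow_unbounded_of_one_lt (L / c) hρ
  refine ⟨t, ?_⟩
  have h1 : (L : ℝ) < c * ρ ^ t := by
    rw [mul_comm]
    exact (div_lt_iff₀ hc).1 ht
  have h2 : c * ρ ^ t ≤ c * ρ ^ (t + 1) :=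
    mul_le_mul_of_nonneg_left (pow_le_pow_right₀ hρ.le t.le_succ) hc.le
  exact_mod_cast (h1.le.trans h2).trans (hle (t + 1))

/-- A finite set of points which agree on `[0, ∞)` is asymptotic in the sense of `Asymptotic`, for
constants which depend on the set, and is covered by the words of some level of the directive
sequence which are long with respect to these constants. -/
theorem card_le_of_forall_eq (hap : Aperiodic τ.shiftMap) {K : ℕ}
    (hK : ∀ t, (τ.alphabet (t + 1)).card ≤ K)
    (hlen : ∀ L : ℕ, ∃ t, L ≤ (τ.composed (t + 1)).minLength)
    {T : Finset (Config (τ.alphabet 0))} (hT : ∀ x ∈ T, x ∈ τ.limitSet)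
    (htail : ∀ x ∈ T, ∀ y ∈ T, ∀ q, 0 ≤ q → x q = y q) : T.card ≤ asymptoticBound K := by
  classical
  have hdist : ∃ D : ℤ, 0 < D ∧
      ∀ x ∈ T, ∀ y ∈ T, (∀ q, -D ≤ q → q < 0 → x q = y q) → x = y := by
    have h1 : ∀ c : Config (τ.alphabet 0) × Config (τ.alphabet 0), ∃ q : ℤ,
        c.1 ≠ c.2 → c.1 q ≠ c.2 q := fun c => by
      by_cases h : c.1 = c.2
      · exact ⟨0, fun h' => absurd h h'⟩
      · obtain ⟨q, hq⟩ := Function.ne_iff.1 h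
        exact ⟨q, fun _ => hq⟩
    choose f hf using h1
    obtain ⟨M, hM⟩ := ((T ×ˢ T).image fun c => -f c).bddAbove
    refine ⟨max M 1, by omega, fun x hx y hy h => ?_⟩
    by_contra hne
    have h2 := hf (x, y) hne
    have h3 : -f (x, y) ≤ M := hM (by
      simp only [Finset.coe_image]
      exact ⟨(x, y), by simp [hx, hy], rfl⟩)
    rcases le_or_gt 0 (f (x, y)) with h0 | h0
    · exact h2 (htail x hx y hy _ h0)
    · exact h2 (h _ (by omega) h0)
  obtain ⟨D, hD, hdist⟩ := hdist
  obtain ⟨G, hG, hrep⟩ := exists_repeats_lt hap D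
  obtain ⟨G', -, hrep'⟩ := exists_repeats_lt hap (D + G)
  obtain ⟨t, ht⟩ := hlen (max (D + G + 1) (G' + D)).toNat
  have hasymp : Asymptotic D G (max (D + G + 1) (G' + D)) T :=
    { D_pos := hD
      G_pos := hG
      lt_L := by omega
      tail := htail
      distinct := hdist
      repeats_lt := fun x hx a c p => hrep x (hT x hx) a c p
      repeats_lt' := fun x hx a c p h1 h2 h3 => by
        have := hrep' x (hT x hx) a c p h1 h2 h3
        omega }
  -- the words of a level whose minimal length exceeds the constants found so far
  set W := Finset.univ.image (τ.composed (t + 1)).word with hW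
  obtain ⟨R, hR⟩ := (W.image List.length).bddAbove
  have hcard : W.card ≤ K := Finset.card_image_le.trans (by simpa using hK t)
  refine card_le_asymptoticBound K T W (4 * R + 1) hcard (fun u hu => ?_) hasymp (by omega)
    (fun u hu => ?_) fun x hx => ?_
  · obtain ⟨b, -, rfl⟩ := Finset.mem_image.1 hu
    have := (τ.composed (t + 1)).minLength_le b
    omega
  · have : u.length ≤ R := hR (Finset.mem_image_of_mem _ hu)
    omega
  · obtain ⟨k, y, h⟩ := Set.mem_iInter.1 (hT x hx) (t + 1)
    exact h.exists_tiles _ _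

theorem finitelyPositivelyExpansive_of_aperiodic (hap : Aperiodic τ.shiftMap) {K : ℕ}
    (hK : ∀ t, (τ.alphabet (t + 1)).card ≤ K)
    (hlen : ∀ L : ℕ, ∃ t, L ≤ (τ.composed (t + 1)).minLength) (d : MetricSpace τ.limitSet)
    (hd : d.toUniformSpace.toTopologicalSpace = τ.limitTopology) :
    FinitelyPositivelyExpansive τ.shiftMap := by
  classical
  obtain ⟨ε, hε, hdist⟩ := exists_dist_lt d hd
  refine ⟨asymptoticBound K + 1, by omega, ε, hε, fun x => ?_⟩
  by_contra hlt
  rw [not_le] at hlt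
  obtain ⟨T, hTsub, hTcard⟩ := Set.exists_subset_encard_eq hlt.le
  have hTfin : T.Finite := Set.finite_of_encard_eq_coe hTcard
  have heq : ∀ y ∈ T, ∀ q, 0 ≤ q → x.1 q = y.1 q := fun y hy q hq => by
    have h1 := hdist _ _ (hTsub hy q.toNat)
    rwa [shiftMap_iterate, shiftMap_iterate, zero_add, Int.toNat_of_nonneg hq] at h1
  have hle := card_le_of_forall_eq hap hK hlen (T := hTfin.toFinset.image Subtype.val)
    (fun z hz => by
      obtain ⟨y, -, rfl⟩ := Finset.mem_image.1 hz
      exact y.2)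
    (fun z hz z' hz' q hq => by
      obtain ⟨y, hy, rfl⟩ := Finset.mem_image.1 hz
      obtain ⟨y', hy', rfl⟩ := Finset.mem_image.1 hz'
      rw [← heq y (hTfin.mem_toFinset.1 hy) q hq, ← heq y' (hTfin.mem_toFinset.1 hy') q hq])
  rw [Finset.card_image_of_injective _ Subtype.val_injective] at hle
  rw [hTfin.encard_eq_coe_toFinset_card] at hTcard
  have : hTfin.toFinset.card = asymptoticBound K + 1 := by exact_mod_cast hTcard
  omega

end DirectiveSequence

end SAdic

/-- The conclusion is stated for every metric on the limit set that induces its topology. -/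
theorem corollaryc {S : Type*} (τ : SAdic.DirectiveSequence S)
    (hfin : τ.Finitary) (hgrow : τ.GrowsExponentially)
    (h : (∀ t, (τ.subst t).Injective ∧ (τ.subst t).QuasiRecognizable) ∨
      SAdic.Aperiodic τ.shiftMap)
    (d : MetricSpace τ.limitSet)
    (hd : d.toUniformSpace.toTopologicalSpace = τ.limitTopology) :
    SAdic.FinitelyPositivelyExpansive τ.shiftMap := by
  obtain ⟨K, hK⟩ := hfin.exists_card_alphabet_le
  have hap : SAdic.Aperiodic τ.shiftMap := h.elim
    (fun h => SAdic.DirectiveSequence.aperiodic_of_recognizable h fun L =>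
      (hgrow.exists_le_minLength L).imp' Nat.succ fun _ ht => ht) id
  exact SAdic.DirectiveSequence.finitelyPositivelyExpansive_of_aperiodic hap hK
    hgrow.exists_le_minLength d hd
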